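/- Let $G$ be a separable locally compact Hausdorff abelian group, written additively, such that $x\mapsto 2x$ is a bijection of $G$. Let $T=\{z\in\mathbf C : |z|=1\}$ and let $m\colon G\times G\to T$ be a symplectic bicharacter, i.e. $m$ is continuous, a homomorphism in each argument, satisfies $m(x,y)m(y,x)=1$ and $m(x,x)=1$, and $y\mapsto m(\cdot,y)$ is an isomorphism of topological groups from $G$ onto its dual $\widehat G$. Let $L\subset G$ be a compact subgroup that is maximal among the subgroups on which $m$ is identically $1$. Put $2L=\{2x : x\in L\}$ and $L/2=\{x\in G : 2x\in L\}$, and assume $L\neq 2L$. For a topological abelian group $X$ and a map $n\colon X\times X\to T$, an $n$-representation of $X$ on a Hilbert space $\mathcal K$ is a map $U$ from $X$ to the unitary operators of $\mathcal K$ with $U(0)=1$ and $U(x)U(y)=n(x,y)U(x+y)$ that is Borel, in the sense that every orbit map $x\mapsto U(x)\psi$ is Borel with separable range; $n$ is called the multiplier of $U$. It is irreducible if $\mathcal K\neq 0$ and the only closed invariant subspaces are $0$ and $\mathcal K$. Let $W$ be an irreducible $m$-representation of $G$ on a complex Hilbert space $\mathcal H$ and let $\mathcal H^L=\{\psi\in\mathcal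 H : W(a)\psi=\psi\ \text{for all } a\in L\}$ be the vacuum space. Then: 1. There is a projective representation $W^L_0$ of $(L/2)/L$ on $\mathcal H^L$, with some multiplier $m_{0,L/2}$, whose lift to $L/2$ is projectively equivalent to $W|_{L/2}$ acting on $\mathcal H^L$; that is, $W^L_0$ is an $m_{0,L/2}$-representation and there is a function $a\colon L/2\to T$ with $W^L_0(x+L)\psi=a(x)W(x)\psi$ for all $x\in L/2$ and $\psi\in\mathcal H^L$. 2. For every such $W^L_0$ and $m_{0,L/2}$, $W^L_0$ is irreducible, and it is the unique irreducible $m_{0,L/2}$-representation of $(L/2)/L$: every irreducible $m_{0,L/2}$-representation of $(L/2)/L$ on a complex Hilbert space is unitarily equivalent to it. 3. There is a positive integer $d$ such that $\dim\mathcal H^L=2^d$ and $|(L/2)/L|=2^{2d}$. -/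

import Mathlib

/-- A bicharacter of a topological abelian group: a continuous map to the circle group
that is a character in each argument. -/
structure IsBicharacter {G : Type*} [AddCommGroup G] [TopologicalSpace G]
    (b : G → G → Circle) : Prop where
  continuous : Continuous (fun p : G × G => b p.1 p.2)
  map_add_left : ∀ x y z, b (x + y) z = b x z * b y z
  map_add_right : ∀ x y z, b x (y + z) = b x y * b x z

/-- A symplectic bicharacter: an alternating bicharacter `b` for which `y ↦ b (·, y)` is an
isomorphism of topological groups from `G` onto its Pontryagin dual. -/
structure IsSymplecticBicharacter {G : Type*} [AddCommGroup G] [TopologicalSpace G]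
    (b : G → G → Circle) : Prop extends IsBicharacter b where
  mul_swap : ∀ x y, b x y * b y x = 1
  self_eq_one : ∀ x, b x x = 1
  iso : ∃ e : Multiplicative G ≃ₜ* PontryaginDual (Multiplicative G),
    ∀ x y : G, e (Multiplicative.ofAdd y) (Multiplicative.ofAdd x) = b x y

/-- A subgroup is isotropic for `b` if `b` is identically `1` on it. -/
def IsIsotropic {G : Type*} [AddCommGroup G] (b : G → G → Circle) (A : AddSubgroup G) : Prop :=
  ∀ x ∈ A, ∀ y ∈ A, b x y = 1

/-- An `m`-representation of `G`: a Borel map `U` of `G` into the unitary group of `H` with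
`U x U y = m(x, y) U (x + y)` and `U 0 = 1`. Borel means that each orbit map `x ↦ U x ψ` is
strongly measurable for the Borel sigma-algebra of `G`; for separable `H` this is the same as
all matrix coefficients being Borel functions. -/
structure IsMRep {G : Type*} [AddCommGroup G] [TopologicalSpace G]
    {H : Type*} [NormedAddCommGroup H] [InnerProductSpace ℂ H]
    (m : G → G → Circle) (U : G → (H ≃ₗᵢ[ℂ] H)) : Prop where
  map_zero : ∀ ψ, U 0 ψ = ψ
  map_map : ∀ x y ψ, U x (U y ψ) = (m x y : ℂ) • U (x + y) ψ
  borel : ∀ ψ, @MeasureTheory.StronglyMeasurable G H _ (borel G) (fun x => U x ψ)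

/-- A family of unitary operators is irreducible if the Hilbert space is nonzero and has no
closed invariant subspaces besides zero and the whole space. -/
structure IsIrreducibleFamily {G : Type*} {H : Type*} [NormedAddCommGroup H]
    [InnerProductSpace ℂ H] (U : G → (H ≃ₗᵢ[ℂ] H)) : Prop where
  nontrivial : Nontrivial H
  eq_bot_or_eq_top : ∀ K : Submodule ℂ H, IsClosed (K : Set H) →
    (∀ x, ∀ ψ ∈ K, U x ψ ∈ K) → K = ⊥ ∨ K = ⊤

/-- `2L`, the image of `L` under `x ↦ 2x`. -/
def doubleSubgroup {G : Type*} [AddCommGroup G] (L : AddSubgroup G) : AddSubgroup G :=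
  L.map (nsmulAddMonoidHom 2)

/-- `L/2`, the inverse image of `L` under `x ↦ 2x`. -/
def halfSubgroup {G : Type*} [AddCommGroup G] (L : AddSubgroup G) : AddSubgroup G :=
  L.comap (nsmulAddMonoidHom 2)

/-- The quotient group `(L/2)/L`, with the quotient topology. -/
abbrev HalfQuotient {G : Type*} [AddCommGroup G] (L : AddSubgroup G) : Type _ :=
  ↥(halfSubgroup L) ⧸ L.addSubgroupOf (halfSubgroup L)

/-- The vacuum space: the vectors fixed by all `W a`, `a ∈ L`. -/
def vacuumSpace {G : Type*} [AddCommGroup G] {H : Type*} [NormedAddCommGroup H]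
    [InnerProductSpace ℂ H] (W : G → (H ≃ₗᵢ[ℂ] H)) (L : AddSubgroup G) : Submodule ℂ H where
  carrier := {ψ | ∀ a ∈ L, W a ψ = ψ}
  add_mem' := by
    intro φ ψ hφ hψ a ha
    rw [map_add, hφ a ha, hψ a ha]
  zero_mem' := by
    intro a _
    exact map_zero (W a)
  smul_mem' := by
    intro c ψ hψ a ha
    rw [map_smul, hψ a ha]

/-- `W₀` is a projective representation of `(L/2)/L` on the vacuum space, with multiplier `m₀`,
whose lift to `L/2` is projectively equivalent to the action of `W` restricted to `L/2`:
`W₀ (x + L) = a x • W x` on the vacuum space, for a circle-valued function `a` on `L/2`. -/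
structure IsVacuumDescent {G : Type*} [AddCommGroup G] [TopologicalSpace G] {H : Type*}
    [NormedAddCommGroup H] [InnerProductSpace ℂ H] (W : G → (H ≃ₗᵢ[ℂ] H)) (L : AddSubgroup G)
    (m₀ : HalfQuotient L → HalfQuotient L → Circle)
    (W₀ : HalfQuotient L → (vacuumSpace W L ≃ₗᵢ[ℂ] vacuumSpace W L)) : Prop where
  isMRep : IsMRep m₀ W₀
  lift : ∃ a : halfSubgroup L → Circle, ∀ (x : halfSubgroup L) (ψ : vacuumSpace W L),
    (W₀ (QuotientAddGroup.mk x) ψ : H) = (a x : ℂ) • W (x : G) (ψ : H)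

/-!
An irreducible projective representation of a finite group with nondegenerate multiplier is
determined by that multiplier: averaging a suitable rank-one operator over the group gives a nonzero
intertwiner between any two, and comparing traces shows that the square of the dimension is the
order of the group. It remains to reduce to this finite situation.

*Finiteness of `(L/2)/L`.* Since `L` is compact and equal to its own annihilator, it is open.
Hence every character of `(L/2)/L` extends to a continuous character of `G`, which has the form
`m (·, 2y)` with `y ∈ L/2`; this embeds the dual of the `𝔽₂`-vector space `(L/2)/L` into `(L/2)/L`,
which is impossible for an infinite space.

*The vacuum.* The characters `m (·, y)` of `L` span a dense subspace of `C(L)`, so some Fourier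
coefficient of the orbit map `a ↦ W a ψ` on `L` is nonzero. It transforms under `L` by a character
`m (·, 2x)⁻¹`, and `W x` moves it into the vacuum space.

*The descent.* For `x ∉ L/2` the operator `W x` maps the vacuum space to its orthogonal complement,
so irreducibility of `W` passes to the action of `L/2` on the vacuum space. The commutator of
the descended multiplier is `m (2x, y)`, which is nondegenerate on `(L/2)/L` because `L` is its own
annihilator.
-/

open MeasureTheory Module
open scoped InnerProductSpace

/-! ### Finite groups with a nondegenerate multiplier -/

theorem circle_smul_left_injective {E : Type*} [AddCommGroup E] [Module ℂ E] {ψ : E}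
    (hψ : ψ ≠ 0) : Function.Injective fun z : Circle => (z : ℂ) • ψ :=
  (smul_left_injective ℂ hψ).comp Circle.coe_injective

/-- The commutator of a multiplier: `U u` and `U v` commute up to this factor in every
`m`-representation `U`. -/
noncomputable def multiplierCommutator {V : Type*} (m : V → V → Circle) (u v : V) : Circle :=
  m u v / m v u

/-- A multiplier is nondegenerate if only `0` commutes with everything up to the trivial factor. -/
def IsNondegenerateMultiplier {V : Type*} [Zero V] (m : V → V → Circle) : Prop :=
  ∀ v ≠ 0, ∃ u, multiplierCommutator m u v ≠ 1

section Representation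

variable {V : Type*} [AddCommGroup V] [TopologicalSpace V] {m : V → V → Circle}
  {A : Type*} [NormedAddCommGroup A] [InnerProductSpace ℂ A] {U : V → (A ≃ₗᵢ[ℂ] A)}

theorem IsMRep.map_map_comm (hU : IsMRep m U) (u v : V) (ψ : A) :
    U u (U v ψ) = (multiplierCommutator m u v : ℂ) • U v (U u ψ) := by
  rw [hU.map_map, hU.map_map v u, smul_smul, ← Circle.coe_mul, multiplierCommutator,
    div_mul_cancel, add_comm]

theorem IsMRep.inner_map_conj (hU : IsMRep m U) (u v : V) (α β : A) :
    ⟪U v (U u α), U u β⟫_ℂ = (multiplierCommutator m u v : ℂ) * ⟪U v α, β⟫_ℂ := by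
  rw [← (U u).inner_map_map (U v α), hU.map_map_comm u v, inner_smul_left, ← mul_assoc,
    ← Circle.coe_inv_eq_conj, ← Circle.coe_mul, mul_inv_cancel, Circle.coe_one, one_mul]

theorem IsMRep.multiplierCommutator_zero_right [Nontrivial A] (hU : IsMRep m U) (u : V) :
    multiplierCommutator m u 0 = 1 := by
  obtain ⟨ψ, hψ⟩ := exists_ne (0 : A)
  refine circle_smul_left_injective ((U u).map_eq_zero_iff.not.2 hψ) ?_
  simpa [hU.map_zero] using (hU.map_map_comm u 0 ψ).symm

theorem IsMRep.multiplierCommutator_add_left [Nontrivial A] (hU : IsMRep m U) (u u' v : V) :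
    multiplierCommutator m (u + u') v =
      multiplierCommutator m u v * multiplierCommutator m u' v := by
  obtain ⟨ψ, hψ⟩ := exists_ne (0 : A)
  let φ := U v (U u (U u' ψ))
  have hφ : φ ≠ 0 := by simpa [φ] using hψ
  refine circle_smul_left_injective hφ ?_
  calc (multiplierCommutator m (u + u') v : ℂ) • φ
      = (m u u' : ℂ) • (multiplierCommutator m (u + u') v : ℂ) • U v (U (u + u') ψ) := by
        simp only [φ, hU.map_map u u', map_smul]
        exact smul_comm _ _ _
    _ = U u (U u' (U v ψ)) := by rw [← hU.map_map_comm, ← hU.map_map u u']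
    _ = ((multiplierCommutator m u v * multiplierCommutator m u' v : Circle) : ℂ) • φ := by
        rw [hU.map_map_comm u' v, map_smul, hU.map_map_comm u v, smul_smul, mul_comm,
          Circle.coe_mul]

theorem IsMRep.eq_zero_of_forall_inner_map_eq_zero (hU : IsMRep m U)
    (hirr : IsIrreducibleFamily U) {φ ψ : A} (hφ : φ ≠ 0) (h : ∀ x, ⟪U x φ, ψ⟫_ℂ = 0) : ψ = 0 := by
  let N : Submodule ℂ A := (⨆ x, ℂ ∙ U x φ)ᗮ
  have mem_N (ξ : A) : ξ ∈ N ↔ ∀ x, ⟪U x φ, ξ⟫_ℂ = 0 := by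
    simp only [N, ← Submodule.iInf_orthogonal, Submodule.mem_iInf,
      Submodule.mem_orthogonal_singleton_iff_inner_right]
  have invariant (y : V) (ξ : A) (hξ : ξ ∈ N) : U y ξ ∈ N := (mem_N _).2 fun x => by
    have hy : ⟪U y (U (x - y) φ), U y ξ⟫_ℂ = 0 := by
      rw [LinearIsometryEquiv.inner_map_map, (mem_N ξ).1 hξ]
    rw [hU.map_map, add_sub_cancel, inner_smul_left] at hy
    exact (mul_eq_zero.1 hy).resolve_left (by simp)
  rcases hirr.eq_bot_or_eq_top N (Submodule.isClosed_orthogonal _) invariant with hN | hN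
  · exact (Submodule.mem_bot ℂ).1 (hN ▸ (mem_N ψ).2 h)
  · have hφ0 := (mem_N φ).1 (hN ▸ Submodule.mem_top) 0
    rw [hU.map_zero, inner_self_eq_zero] at hφ0
    exact absurd hφ0 hφ

theorem IsMRep.finiteDimensional [Finite V] (hU : IsMRep m U) (hirr : IsIrreducibleFamily U) :
    FiniteDimensional ℂ A := by
  have := hirr.nontrivial
  obtain ⟨φ, hφ⟩ := exists_ne (0 : A)
  let K : Submodule ℂ A := Submodule.span ℂ (Set.range fun x => U x φ)
  have : FiniteDimensional ℂ K := FiniteDimensional.span_of_finite ℂ (Set.finite_range _)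
  have hK : K = ⊤ := K.orthogonal_eq_bot_iff.1 <| (Submodule.eq_bot_iff _).2 fun ψ hψ =>
    hU.eq_zero_of_forall_inner_map_eq_zero hirr hφ fun x =>
      hψ _ (Submodule.subset_span (Set.mem_range_self x))
  exact Module.finite_def.2 (hK ▸ (Submodule.fg_iff_finiteDimensional K).2 inferInstance)

theorem IsMRep.sum_multiplierCommutator_eq_zero [Nontrivial A] [Fintype V] (hU : IsMRep m U)
    (hm : IsNondegenerateMultiplier m) {v : V} (hv : v ≠ 0) :
    ∑ u, (multiplierCommutator m u v : ℂ) = 0 := by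
  obtain ⟨u₀, hu₀⟩ := hm v hv
  have translate : (multiplierCommutator m u₀ v : ℂ) * ∑ u, (multiplierCommutator m u v : ℂ) =
      ∑ u, (multiplierCommutator m u v : ℂ) := by
    rw [Finset.mul_sum]
    refine Fintype.sum_equiv (Equiv.addLeft u₀) _ _ fun u => ?_
    rw [Equiv.coe_addLeft, hU.multiplierCommutator_add_left, Circle.coe_mul]
  by_contra h0
  exact hu₀ (Circle.coe_eq_one.1 ((mul_eq_right₀ h0).1 translate))

end Representation

section Schur

variable {V : Type*} {A : Type*} [NormedAddCommGroup A] [InnerProductSpace ℂ A]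
  [FiniteDimensional ℂ A] {B : Type*} [NormedAddCommGroup B] [InnerProductSpace ℂ B]
  {U : V → (A ≃ₗᵢ[ℂ] A)} {U' : V → (B ≃ₗᵢ[ℂ] B)}

theorem IsIrreducibleFamily.exists_eq_smul (hU : IsIrreducibleFamily U) (S : A →ₗ[ℂ] A)
    (hS : ∀ v ψ, S (U v ψ) = U v (S ψ)) : ∃ c : ℂ, ∀ ψ, S ψ = c • ψ := by
  have := hU.nontrivial
  obtain ⟨c, hc⟩ := Module.End.exists_eigenvalue S
  refine ⟨c, fun ψ => ?_⟩
  have invariant (v : V) (φ : A) (hφ : φ ∈ Module.End.eigenspace S c) :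
      U v φ ∈ Module.End.eigenspace S c := by
    rw [Module.End.mem_eigenspace_iff] at hφ ⊢
    rw [hS, hφ, map_smul]
  have htop := (hU.eq_bot_or_eq_top _ (Submodule.closed_of_finiteDimensional _)
    invariant).resolve_left hc
  exact Module.End.mem_eigenspace_iff.1 (htop ▸ Submodule.mem_top)

theorem IsIrreducibleFamily.exists_norm_map_eq [FiniteDimensional ℂ B]
    (hU : IsIrreducibleFamily U) (T : A →ₗ[ℂ] B) (hT : ∀ v ψ, T (U v ψ) = U' v (T ψ)) :
    ∃ r : ℝ, ∀ ψ, ‖T ψ‖ = r * ‖ψ‖ := by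
  have adjoint_comm (v : V) (ψ : A) :
      (T.adjoint ∘ₗ T) (U v ψ) = U v ((T.adjoint ∘ₗ T) ψ) := by
    refine ext_inner_right ℂ fun φ => ?_
    obtain ⟨η, rfl⟩ := (U v).surjective φ
    simp only [LinearMap.comp_apply, hT, LinearMap.adjoint_inner_left,
      LinearIsometryEquiv.inner_map_map]
  obtain ⟨c, hc⟩ := hU.exists_eq_smul (T.adjoint ∘ₗ T) adjoint_comm
  refine ⟨√c.re, fun ψ => ?_⟩
  have hsq : ‖T ψ‖ ^ 2 = c.re * ‖ψ‖ ^ 2 := by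
    rw [← inner_self_eq_norm_sq (𝕜 := ℂ), ← LinearMap.adjoint_inner_right, ← LinearMap.comp_apply,
      hc, inner_smul_right, inner_self_eq_norm_sq_to_K, ← RCLike.ofReal_pow]
    exact Complex.re_mul_ofReal _ _
  rw [← Real.sqrt_sq (norm_nonneg (T ψ)), hsq, Real.sqrt_mul' _ (sq_nonneg _),
    Real.sqrt_sq (norm_nonneg ψ)]

theorem IsIrreducibleFamily.exists_unitary_of_intertwiner [FiniteDimensional ℂ B]
    (hU : IsIrreducibleFamily U) (hU' : IsIrreducibleFamily U') (T : A →ₗ[ℂ] B) (hT0 : T ≠ 0)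
    (hT : ∀ v ψ, T (U v ψ) = U' v (T ψ)) :
    ∃ S : A ≃ₗᵢ[ℂ] B, ∀ v ψ, S (U v ψ) = U' v (S ψ) := by
  obtain ⟨r, hr⟩ := hU.exists_norm_map_eq T hT
  obtain ⟨φ, hφ⟩ := DFunLike.ne_iff.1 hT0
  have hr0 : 0 < r := pos_of_mul_pos_left (hr φ ▸ norm_pos_iff.2 hφ) (norm_nonneg φ)
  let J : A →ₗᵢ[ℂ] B :=
    { toLinearMap := ((r⁻¹ : ℝ) : ℂ) • T
      norm_map' := fun ψ => by
        rw [LinearMap.smul_apply, norm_smul, hr, Complex.norm_real,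
          Real.norm_of_nonneg (inv_pos.2 hr0).le, inv_mul_cancel_left₀ hr0.ne'] }
  have hJ (v : V) (ψ : A) : J (U v ψ) = U' v (J ψ) := by simp [J, hT]
  have hJφ : J φ ≠ 0 := by simpa [J, hr0.ne'] using hφ
  have invariant (v : V) : ∀ ξ ∈ LinearMap.range J.toLinearMap,
      U' v ξ ∈ LinearMap.range J.toLinearMap := by
    rintro _ ⟨ψ, rfl⟩
    exact ⟨U v ψ, hJ v ψ⟩
  have hsurj : Function.Surjective J := LinearMap.range_eq_top.1 <|
    (hU'.eq_bot_or_eq_top _ (Submodule.closed_of_finiteDimensional _) invariant).resolve_left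
      fun h => hJφ ((Submodule.eq_bot_iff _).1 h _ ⟨φ, rfl⟩)
  exact ⟨LinearIsometryEquiv.ofSurjective J hsurj, hJ⟩

end Schur

section Twirl

variable {V : Type*} [Fintype V]
  {A : Type*} [NormedAddCommGroup A] [InnerProductSpace ℂ A]
  {B : Type*} [NormedAddCommGroup B] [InnerProductSpace ℂ B]

/-- The average of the rank-one operator `β ⊗ α*` over a finite group acting on both sides, scaled
by the order of the group; it intertwines `U` and `U'` when these have the same multiplier. -/
noncomputable def rankOneTwirl (U : V → (A ≃ₗᵢ[ℂ] A)) (U' : V → (B ≃ₗᵢ[ℂ] B)) (α : A) (β : B) :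
    A →L[ℂ] B :=
  ∑ v, InnerProductSpace.rankOne ℂ (U' v β) (U v α)

theorem rankOneTwirl_apply (U : V → (A ≃ₗᵢ[ℂ] A)) (U' : V → (B ≃ₗᵢ[ℂ] B)) (α ξ : A) (β : B) :
    rankOneTwirl U U' α β ξ = ∑ v, ⟪U v α, ξ⟫_ℂ • U' v β := by
  simp [rankOneTwirl]

variable [AddCommGroup V] [TopologicalSpace V] {m : V → V → Circle} {U : V → (A ≃ₗᵢ[ℂ] A)}
  {U' : V → (B ≃ₗᵢ[ℂ] B)}

theorem IsMRep.rankOneTwirl_map (hU : IsMRep m U) (hU' : IsMRep m U') (α ξ : A) (β : B) (w : V) :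
    rankOneTwirl U U' α β (U w ξ) = U' w (rankOneTwirl U U' α β ξ) := by
  rw [rankOneTwirl_apply, rankOneTwirl_apply, map_sum]
  refine (Fintype.sum_equiv (Equiv.addLeft w) _ _ fun v => ?_).symm
  calc U' w (⟪U v α, ξ⟫_ℂ • U' v β)
      = (⟪U w (U v α), U w ξ⟫_ℂ * m w v) • U' (w + v) β := by
        rw [map_smul, hU'.map_map, smul_smul, LinearIsometryEquiv.inner_map_map]
    _ = ⟪U (w + v) α, U w ξ⟫_ℂ • U' (w + v) β := by
        rw [hU.map_map, inner_smul_left, mul_right_comm, ← Circle.coe_inv_eq_conj,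
          ← Circle.coe_mul, inv_mul_cancel, Circle.coe_one, one_mul]

/-- Conjugating by `U u` multiplies the `v`-th term of the twirl by a character of `u`, so that only
the term `v = 0` survives the sum over `u`. -/
theorem IsMRep.sum_rankOneTwirl_map (hU : IsMRep m U) (hU' : IsMRep m U')
    (hm : IsNondegenerateMultiplier m) (α : A) (β : B) :
    ∑ u, rankOneTwirl U U' (U u α) β (U u α) = (Fintype.card V * ⟪α, α⟫_ℂ) • β := by
  rcases eq_or_ne α 0 with rfl | hα
  · simp
  have : Nontrivial A := ⟨α, 0, hα⟩
  simp_rw [rankOneTwirl_apply, hU.inner_map_conj]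
  rw [Finset.sum_comm, Finset.sum_eq_single 0]
  · simp [hU.map_zero, hU'.map_zero, hU.multiplierCommutator_zero_right, mul_smul,
      Nat.cast_smul_eq_nsmul]
  · intro v _ hv
    rw [← Finset.sum_smul, ← Finset.sum_mul, hU.sum_multiplierCommutator_eq_zero hm hv, zero_mul,
      zero_smul]
  · exact fun h => absurd (Finset.mem_univ _) h

theorem IsMRep.finrank_smul_rankOneTwirl (hU : IsMRep m U) (hirr : IsIrreducibleFamily U)
    (α β ξ : A) :
    (finrank ℂ A : ℂ) • rankOneTwirl U U α β ξ = (Fintype.card V * ⟪α, β⟫_ℂ) • ξ := by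
  have := hU.finiteDimensional hirr
  let T : A →ₗ[ℂ] A := (rankOneTwirl U U α β).toLinearMap
  obtain ⟨c, hc⟩ := hirr.exists_eq_smul T fun v ψ => hU.rankOneTwirl_map hU α ψ β v
  have trace_eq_sum : LinearMap.trace ℂ A T = Fintype.card V * ⟪α, β⟫_ℂ := by
    simp [T, rankOneTwirl, InnerProductSpace.trace_rankOne]
  have trace_eq_smul : LinearMap.trace ℂ A T = finrank ℂ A * c := by
    rw [show T = c • LinearMap.id from LinearMap.ext hc, map_smul, LinearMap.trace_id,
      smul_eq_mul, mul_comm]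
  rw [← trace_eq_sum, trace_eq_smul, mul_smul]
  exact congrArg _ (hc ξ)

end Twirl

section FiniteGroup

variable {V : Type*} [AddCommGroup V] [Finite V] [TopologicalSpace V] {m : V → V → Circle}
  {A : Type*} [NormedAddCommGroup A] [InnerProductSpace ℂ A] {U : V → (A ≃ₗᵢ[ℂ] A)}
  {B : Type*} [NormedAddCommGroup B] [InnerProductSpace ℂ B] {U' : V → (B ≃ₗᵢ[ℂ] B)}

theorem IsMRep.exists_unitary_equiv (hU : IsMRep m U) (hU' : IsMRep m U')
    (hm : IsNondegenerateMultiplier m) (hirr : IsIrreducibleFamily U)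
    (hirr' : IsIrreducibleFamily U') : ∃ S : A ≃ₗᵢ[ℂ] B, ∀ v ψ, S (U v ψ) = U' v (S ψ) := by
  have := Fintype.ofFinite V
  have := hirr.nontrivial
  have := hirr'.nontrivial
  have := hU.finiteDimensional hirr
  have := hU'.finiteDimensional hirr'
  obtain ⟨α, hα⟩ := exists_ne (0 : A)
  obtain ⟨β, hβ⟩ := exists_ne (0 : B)
  have hsum : ∑ u, rankOneTwirl U U' (U u α) β (U u α) ≠ 0 := by
    rw [hU.sum_rankOneTwirl_map hU' hm]
    simp [hα, hβ]
  obtain ⟨u, -, hu⟩ := Finset.exists_ne_zero_of_sum_ne_zero hsum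
  exact hirr.exists_unitary_of_intertwiner hirr' (rankOneTwirl U U' (U u α) β).toLinearMap
    (fun h => hu (LinearMap.congr_fun h _)) fun v ψ => hU.rankOneTwirl_map hU' _ ψ β v

theorem IsMRep.finrank_sq_eq_card (hU : IsMRep m U) (hm : IsNondegenerateMultiplier m)
    (hirr : IsIrreducibleFamily U) : finrank ℂ A ^ 2 = Nat.card V := by
  have := Fintype.ofFinite V
  have := hirr.nontrivial
  obtain ⟨α, hα⟩ := exists_ne (0 : A)
  let n : ℂ := finrank ℂ A
  let N : ℂ := Fintype.card V
  have smul_twirl (φ ξ : A) : n • rankOneTwirl U U φ α ξ = (N * ⟪φ, α⟫_ℂ) • ξ :=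
    hU.finrank_smul_rankOneTwirl hirr φ α ξ
  have sum_twirl : ∑ u, rankOneTwirl U U (U u α) α (U u α) = (N * ⟪α, α⟫_ℂ) • α :=
    hU.sum_rankOneTwirl_map hU hm α α
  have key : (n ^ 2 * (N * ⟪α, α⟫_ℂ)) • α = (N * (N * ⟪α, α⟫_ℂ)) • α := by
    calc (n ^ 2 * (N * ⟪α, α⟫_ℂ)) • α
        = n • ∑ u, n • rankOneTwirl U U (U u α) α (U u α) := by
          rw [← Finset.smul_sum, sum_twirl, smul_smul, smul_smul, sq]
      _ = n • ∑ u, (N * ⟪U u α, α⟫_ℂ) • U u α := by simp_rw [smul_twirl]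
      _ = N • n • rankOneTwirl U U α α α := by
          simp_rw [rankOneTwirl_apply, mul_smul, ← Finset.smul_sum, smul_comm n N]
      _ = (N * (N * ⟪α, α⟫_ℂ)) • α := by rw [smul_twirl, smul_smul]
  have hN : N * ⟪α, α⟫_ℂ ≠ 0 := by simp [N, hα]
  have hnN : (finrank ℂ A : ℂ) ^ 2 = Fintype.card V :=
    mul_right_cancel₀ hN (smul_left_injective ℂ hα key)
  rw [Nat.card_eq_fintype_card]
  exact_mod_cast hnN

end FiniteGroup

/-! ### Bicharacters and maximal isotropic subgroups -/

section Bicharacter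

variable {G : Type*} [AddCommGroup G] [TopologicalSpace G] {m : G → G → Circle}

theorem IsBicharacter.map_zero_left (hm : IsBicharacter m) (x : G) : m 0 x = 1 := by
  simpa using hm.map_add_left 0 0 x

theorem IsBicharacter.map_zero_right (hm : IsBicharacter m) (x : G) : m x 0 = 1 := by
  simpa using hm.map_add_right x 0 0

theorem IsBicharacter.map_neg_left (hm : IsBicharacter m) (x y : G) : m (-x) y = (m x y)⁻¹ := by
  rw [eq_inv_iff_mul_eq_one, ← hm.map_add_left, neg_add_cancel, hm.map_zero_left]

theorem IsBicharacter.map_neg_right (hm : IsBicharacter m) (x y : G) : m x (-y) = (m x y)⁻¹ := by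
  rw [eq_inv_iff_mul_eq_one, ← hm.map_add_right, neg_add_cancel, hm.map_zero_right]

theorem IsBicharacter.map_two_nsmul (hm : IsBicharacter m) (x y : G) :
    m (2 • x) y = m x (2 • y) := by
  rw [two_nsmul, two_nsmul, hm.map_add_left, hm.map_add_right]

theorem IsSymplecticBicharacter.swap (hm : IsSymplecticBicharacter m) (x y : G) :
    m x y = (m y x)⁻¹ :=
  eq_inv_of_mul_eq_one_left (hm.mul_swap x y)

theorem IsSymplecticBicharacter.multiplierCommutator_eq (hm : IsSymplecticBicharacter m)
    (x y : G) : multiplierCommutator m x y = m (2 • x) y := by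
  rw [multiplierCommutator, hm.swap y x, div_inv_eq_mul, two_nsmul, hm.map_add_left]

theorem IsSymplecticBicharacter.eq_of_forall_eq (hm : IsSymplecticBicharacter m) {x y : G}
    (h : ∀ z, m x z = m y z) : x = y := by
  obtain ⟨e, he⟩ := hm.iso
  refine Multiplicative.ofAdd.injective (e.injective (DFunLike.ext _ _ fun z => ?_))
  change e _ (Multiplicative.ofAdd z.toAdd) = e _ (Multiplicative.ofAdd z.toAdd)
  rw [he, he, hm.swap, h, ← hm.swap]

theorem IsSymplecticBicharacter.exists_eq_of_continuous (hm : IsSymplecticBicharacter m)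
    {χ : AddChar G Circle} (hχ : Continuous χ) : ∃ y, ∀ x, χ x = m x y := by
  obtain ⟨e, he⟩ := hm.iso
  obtain ⟨y, hy⟩ := e.surjective ⟨χ.toMonoidHom, hχ.comp continuous_toAdd⟩
  exact ⟨y.toAdd, fun x => by rw [← he, ofAdd_toAdd, hy]; rfl⟩

theorem IsBicharacter.isIsotropic_closure (hm : IsBicharacter m) {s : Set G}
    (hs : ∀ x ∈ s, ∀ y ∈ s, m x y = 1) : IsIsotropic m (AddSubgroup.closure s) := by
  intro x hx y hy
  induction hx, hy using AddSubgroup.closure_induction₂ with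
  | mem x y hx hy => exact hs x hx y hy
  | zero_left y _ => exact hm.map_zero_left y
  | zero_right x _ => exact hm.map_zero_right x
  | add_left x y z _ _ _ h₁ h₂ => rw [hm.map_add_left, h₁, h₂, one_mul]
  | add_right x y z _ _ _ h₁ h₂ => rw [hm.map_add_right, h₁, h₂, one_mul]
  | neg_left x y _ _ h => rw [hm.map_neg_left, h, inv_one]
  | neg_right x y _ _ h => rw [hm.map_neg_right, h, inv_one]

variable {L : AddSubgroup G}

theorem IsSymplecticBicharacter.mem_iff_of_maximal (hm : IsSymplecticBicharacter m)
    (hL : Maximal (IsIsotropic m) L) {x : G} : x ∈ L ↔ ∀ a ∈ L, m a x = 1 := by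
  refine ⟨fun hx a ha => hL.prop a ha x hx, fun hx => ?_⟩
  have isotropic : IsIsotropic m (AddSubgroup.closure (insert x (L : Set G))) := by
    refine hm.isIsotropic_closure ?_
    rintro y (rfl | hy) z (rfl | hz)
    · exact hm.self_eq_one _
    · rw [hm.swap, hx z hz, inv_one]
    · exact hx y hy
    · exact hL.prop y hy z hz
  have le_closure : L ≤ AddSubgroup.closure (insert x (L : Set G)) :=
    (Set.subset_insert x _).trans AddSubgroup.subset_closure
  exact hL.le_of_ge isotropic le_closure (AddSubgroup.subset_closure (Set.mem_insert x _))

theorem IsSymplecticBicharacter.mem_halfSubgroup_iff (hm : IsSymplecticBicharacter m)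
    (hL : Maximal (IsIsotropic m) L) {x : G} :
    x ∈ halfSubgroup L ↔ ∀ a ∈ L, m (2 • a) x = 1 := by
  simp_rw [hm.map_two_nsmul]
  exact hm.mem_iff_of_maximal hL

theorem IsSymplecticBicharacter.mem_iff_forall_halfSubgroup (hm : IsSymplecticBicharacter m)
    (h2 : Function.Surjective fun x : G => 2 • x) (hL : Maximal (IsIsotropic m) L) {x : G} :
    x ∈ L ↔ ∀ y ∈ halfSubgroup L, m (2 • y) x = 1 := by
  rw [hm.mem_iff_of_maximal hL, h2.forall]
  rfl

/-- The dual of the compact group `L` is discrete, and `L` is the kernel of the restriction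
`y ↦ m (·, y)` from `G` to the dual of `L`. -/
theorem IsSymplecticBicharacter.isOpen_of_maximal (hm : IsSymplecticBicharacter m)
    (hL : Maximal (IsIsotropic m) L) (hLc : IsCompact (L : Set G)) : IsOpen (L : Set G) := by
  have : CompactSpace L := isCompact_iff_compactSpace.1 hLc
  obtain ⟨e, he⟩ := hm.iso
  let ι : Multiplicative L →ₜ* Multiplicative G :=
    { toMonoidHom := L.subtype.toMultiplicative
      continuous_toFun := continuous_ofAdd.comp (continuous_subtype_val.comp continuous_toAdd) }
  let r : Multiplicative G →ₜ* PontryaginDual (Multiplicative L) := (PontryaginDual.map ι).comp e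
  have : CompactSpace (Multiplicative L) := inferInstanceAs (CompactSpace L)
  have hker : (L : Set G) = (fun y => r (Multiplicative.ofAdd y)) ⁻¹' {1} := by
    ext y
    have hr (a : L) : r (Multiplicative.ofAdd y) (Multiplicative.ofAdd a) = m a y := he a y
    rw [SetLike.mem_coe, hm.mem_iff_of_maximal hL, Set.mem_preimage, Set.mem_singleton_iff]
    exact ⟨fun h => PontryaginDual.ext fun a => (hr a.toAdd).trans (h _ a.toAdd.2),
      fun h a ha => (hr ⟨a, ha⟩).symm.trans (by rw [h]; rfl)⟩
  rw [hker]
  exact (isOpen_discrete _).preimage (r.continuous.comp continuous_ofAdd)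

end Bicharacter

/-! ### Finiteness of `(L/2)/L` -/

section Character

theorem exists_addChar_extension {G : Type*} [AddCommGroup G] (N : AddSubgroup G)
    (χ : AddChar N Circle) : ∃ χ' : AddChar G Circle, ∀ x : N, χ' x = χ x := by
  let : DivisibleBy (Additive Circle) ℤ :=
    Function.Surjective.divisibleBy Circle.expHom Circle.exp_surjective fun t n =>
      map_zsmul Circle.expHom n t
  obtain ⟨h, hh⟩ := (Module.Baer.of_divisible (Additive Circle)).extension_property_addMonoidHom
    N.subtype N.subtype_injective (AddChar.toAddMonoidHomEquiv χ)
  exact ⟨AddChar.toAddMonoidHomEquiv.symm h, fun x => DFunLike.congr_fun hh x⟩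

theorem continuous_addChar_of_isOpen {G : Type*} [AddCommGroup G] [TopologicalSpace G]
    [IsTopologicalAddGroup G] {N : AddSubgroup G} (hN : IsOpen (N : Set G)) {χ : AddChar G Circle}
    (hχ : ∀ x ∈ N, χ x = 1) : Continuous χ := by
  have hone : (fun _ => 1) =ᶠ[nhds 0] χ :=
    Filter.eventually_of_mem (hN.mem_nhds N.zero_mem) fun x hx => (hχ x hx).symm
  exact continuous_of_continuousAt_zero (AddChar.toAddMonoidHomEquiv χ)
    (continuousAt_const.congr hone)

/-- An infinite vector space over a prime field has the cardinality of its bases, but more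
characters than a basis has subsets. -/
theorem finite_of_injective_addChar {p : ℕ} [Fact p.Prime] {V : Type*} [AddCommGroup V]
    [Module (ZMod p) V] {f : AddChar V Circle → V} (hf : Function.Injective f) : Finite V := by
  let b := Module.Basis.ofVectorSpace (ZMod p) V
  rcases finite_or_infinite (Module.Basis.ofVectorSpaceIndex (ZMod p) V) with hfin | hinf
  · have := Module.Finite.of_basis b
    exact Module.finite_of_finite (ZMod p)
  exfalso
  let χ (S : Set (Module.Basis.ofVectorSpaceIndex (ZMod p) V)) : AddChar V Circle :=
    (ZMod.toCircle (N := p)).compAddMonoidHom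
      (b.constr (ZMod p) (S.indicator 1)).toAddMonoidHom
  have hχ : Function.Injective χ := fun S T hST => by
    refine Set.indicator_one_inj (ZMod p) (funext fun i => ZMod.injective_toCircle ?_)
    simpa [χ] using DFunLike.congr_fun hST (b i)
  obtain ⟨e⟩ : Nonempty (V ≃ Module.Basis.ofVectorSpaceIndex (ZMod p) V) := by
    refine Cardinal.eq.1 ?_
    rw [b.repr.toEquiv.cardinal_eq, Cardinal.mk_finsupp_lift_of_infinite]
    simpa using Cardinal.natCast_le_aleph0.trans (Cardinal.aleph0_le_mk _)
  exact Function.cantor_injective _ (e.injective.comp (hf.comp hχ))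

end Character

section HalfQuotient

variable {G : Type*} [AddCommGroup G] {L : AddSubgroup G}

theorem HalfQuotient.two_nsmul_eq_zero (v : HalfQuotient L) : 2 • v = 0 := by
  obtain ⟨x, rfl⟩ := QuotientAddGroup.mk_surjective v
  exact (QuotientAddGroup.eq_zero_iff (2 • x)).2 x.2

/-- `(L/2)/L` is a vector space over the field with two elements. -/
noncomputable instance HalfQuotient.instModuleZModTwo : Module (ZMod 2) (HalfQuotient L) :=
  AddCommGroup.zmodModule HalfQuotient.two_nsmul_eq_zero

theorem eq_doubleSubgroup_of_subsingleton (h2 : Function.Surjective fun x : G => 2 • x)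
    [Subsingleton (HalfQuotient L)] : L = doubleSubgroup L := by
  have half_le : halfSubgroup L ≤ L :=
    AddSubgroup.addSubgroupOf_eq_top.1 (QuotientAddGroup.subsingleton_iff.1 inferInstance)
  refine le_antisymm (fun a ha => ?_)
    (AddSubgroup.map_le_iff_le_comap.2 fun a ha => L.nsmul_mem ha 2)
  obtain ⟨x, rfl⟩ := h2 a
  exact ⟨x, half_le ha, rfl⟩

variable [TopologicalSpace G] [IsTopologicalAddGroup G] {m : G → G → Circle}

theorem IsSymplecticBicharacter.discreteTopology_halfQuotient (hm : IsSymplecticBicharacter m)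
    (hL : Maximal (IsIsotropic m) L) (hLc : IsCompact (L : Set G)) :
    DiscreteTopology (HalfQuotient L) :=
  QuotientAddGroup.discreteTopology
    ((hm.isOpen_of_maximal hL hLc).preimage continuous_subtype_val)

theorem IsSymplecticBicharacter.exists_addChar_halfQuotient_eq (hm : IsSymplecticBicharacter m)
    (h2 : Function.Surjective fun x : G => 2 • x) (hL : Maximal (IsIsotropic m) L)
    (hLc : IsCompact (L : Set G)) (χ : AddChar (HalfQuotient L) Circle) :
    ∃ y : halfSubgroup L, ∀ x : halfSubgroup L, χ (QuotientAddGroup.mk x) = m (2 • x) y := by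
  obtain ⟨χ', hχ'⟩ := exists_addChar_extension (halfSubgroup L)
    (χ.compAddMonoidHom (QuotientAddGroup.mk' (L.addSubgroupOf (halfSubgroup L))))
  have trivial_on_L (a : G) (ha : a ∈ L) : χ' a = 1 := by
    have hmk : (QuotientAddGroup.mk ⟨a, L.nsmul_mem ha 2⟩ : HalfQuotient L) = 0 :=
      (QuotientAddGroup.eq_zero_iff _).2 ha
    exact (hχ' ⟨a, _⟩).trans ((congrArg χ hmk).trans χ.map_zero_eq_one)
  obtain ⟨z, hz⟩ := hm.exists_eq_of_continuous
    (continuous_addChar_of_isOpen (hm.isOpen_of_maximal hL hLc) trivial_on_L)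
  have hzL : z ∈ L := (hm.mem_iff_of_maximal hL).2 fun a ha => (hz a).symm.trans (trivial_on_L a ha)
  obtain ⟨y, rfl⟩ := h2 z
  exact ⟨⟨y, hzL⟩, fun x => (hχ' x).symm.trans ((hz x).trans (hm.map_two_nsmul x y).symm)⟩

theorem IsSymplecticBicharacter.finite_halfQuotient (hm : IsSymplecticBicharacter m)
    (h2 : Function.Surjective fun x : G => 2 • x) (hL : Maximal (IsIsotropic m) L)
    (hLc : IsCompact (L : Set G)) : Finite (HalfQuotient L) := by
  choose y hy using hm.exists_addChar_halfQuotient_eq h2 hL hLc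
  refine finite_of_injective_addChar (p := 2) (f := fun χ => QuotientAddGroup.mk (y χ))
    fun χ χ' h => DFunLike.ext _ _ (QuotientAddGroup.mk_surjective.forall.2 fun x => ?_)
  have hmk : (QuotientAddGroup.mk (y χ) : HalfQuotient L) = QuotientAddGroup.mk (y χ') := h
  have mem_L : -y χ + y χ' ∈ L.addSubgroupOf (halfSubgroup L) := QuotientAddGroup.eq.1 hmk
  have hdiff : m (2 • x) (-y χ + y χ') = 1 := hL.prop _ x.2 _ mem_L
  rw [hm.map_add_right, hm.map_neg_right, inv_mul_eq_one] at hdiff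
  rw [hy, hy, hdiff]

end HalfQuotient

/-! ### Existence of vacuum vectors -/

section Density

theorem topologicalClosure_span_eq_top_of_separatesPoints {X : Type*} [TopologicalSpace X]
    [CompactSpace X] (M : Submonoid C(X, ℂ)) (hstar : ∀ f ∈ M, star f ∈ M)
    (hsep : ∀ x y : X, x ≠ y → ∃ f ∈ M, f x ≠ f y) :
    (Submodule.span ℂ (M : Set C(X, ℂ))).topologicalClosure = ⊤ := by
  have hS : Subalgebra.toSubmodule (StarAlgebra.adjoin ℂ (M : Set C(X, ℂ))).toSubalgebra =
      Submodule.span ℂ (M : Set C(X, ℂ)) := by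
    have hM : star (M : Set C(X, ℂ)) ⊆ M := fun f hf => star_star f ▸ hstar _ hf
    rw [StarAlgebra.adjoin_toSubalgebra, Set.union_eq_self_of_subset_right hM,
      Algebra.adjoin_eq_span, Submonoid.closure_eq]
  have hdense := ContinuousMap.starSubalgebra_topologicalClosure_eq_top_of_separatesPoints
    (StarAlgebra.adjoin ℂ (M : Set C(X, ℂ))) fun x y hxy =>
      let ⟨f, hf, hne⟩ := hsep x y hxy
      ⟨f, ⟨f, StarAlgebra.subset_adjoin ℂ _ hf, rfl⟩, hne⟩
  rw [← hS]
  exact SetLike.ext fun f => SetLike.ext_iff.1 hdense f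

variable {X : Type*} [TopologicalSpace X] [CompactSpace X] [T2Space X] [MeasurableSpace X]
  [BorelSpace X] {μ : Measure X} [IsFiniteMeasure μ] [μ.WeaklyRegular] {s : Set C(X, ℂ)}

theorem ae_eq_zero_of_forall_integral_mul_eq_zero
    (hs : (Submodule.span ℂ s).topologicalClosure = ⊤) {g : X → ℂ} (hg : MemLp g 2 μ)
    (h : ∀ f ∈ s, ∫ x, f x * g x ∂μ = 0) : g =ᵐ[μ] 0 := by
  let Λ : C(X, ℂ) →L[ℂ] ℂ := innerSL ℂ (hg.star.toLp _) ∘L ContinuousMap.toLp 2 μ ℂ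
  have hΛ (f : C(X, ℂ)) : Λ f = ∫ x, f x * g x ∂μ := by
    change ⟪hg.star.toLp _, ContinuousMap.toLp 2 μ ℂ f⟫_ℂ = _
    rw [L2.inner_def]
    refine integral_congr_ae ?_
    filter_upwards [hg.star.coeFn_toLp, ContinuousMap.coeFn_toLp (p := 2) (𝕜 := ℂ) μ f]
      with x hx hx'
    rw [hx, hx']
    simp
  have hΛ0 : Λ = 0 :=
    ContinuousLinearMap.ext_on (Submodule.dense_iff_topologicalClosure_eq_top.2 hs)
      fun f hf => (hΛ f).trans (h f hf)
  have hzero : hg.star.toLp _ = 0 :=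
    (ContinuousMap.toLp_denseRange ℂ μ ℂ (by simp)).eq_zero_of_inner_left ℂ fun f =>
      DFunLike.congr_fun hΛ0 f
  filter_upwards [hg.star.coeFn_toLp, (Lp.eq_zero_iff_ae_eq_zero).1 hzero] with x hx hx0
  exact star_eq_zero.1 (hx.symm.trans hx0)

theorem ae_eq_zero_of_forall_integral_smul_eq_zero {E : Type*} [NormedAddCommGroup E]
    [NormedSpace ℂ E] [CompleteSpace E] (hs : (Submodule.span ℂ s).topologicalClosure = ⊤)
    {F : X → E} (hF : MemLp F 2 μ) (h : ∀ f ∈ s, ∫ x, f x • F x ∂μ = 0) : F =ᵐ[μ] 0 := by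
  obtain ⟨t, ht, hFt⟩ := hF.1.isSeparable_ae_range
  refine ae_eq_zero_of_forall_dual_of_isSeparable ℂ ht (fun c => ?_) hFt
  refine ae_eq_zero_of_forall_integral_mul_eq_zero hs (c.comp_memLp' hF) fun f hf => ?_
  have hint : Integrable (fun x => f x • F x) μ :=
    (hF.integrable one_le_two).bdd_smul ‖f‖ f.continuous.aestronglyMeasurable
      (.of_forall f.norm_coe_le_norm)
  calc ∫ x, f x * c (F x) ∂μ = c (∫ x, f x • F x ∂μ) := by
        simp [← c.integral_comp_comm hint]
    _ = 0 := by rw [h f hf, map_zero]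

end Density

section Vacuum

variable {G : Type*} [AddCommGroup G] [TopologicalSpace G] {m : G → G → Circle}
  {H : Type*} [NormedAddCommGroup H] [InnerProductSpace ℂ H] {W : G → (H ≃ₗᵢ[ℂ] H)}
  {L : AddSubgroup G}

theorem IsMRep.map_comm (hW : IsMRep m W) (hm : IsSymplecticBicharacter m) (x y : G) (ψ : H) :
    W x (W y ψ) = (m (2 • x) y : ℂ) • W y (W x ψ) := by
  rw [hW.map_map_comm, hm.multiplierCommutator_eq]

/-- The restriction of `m (·, y)` to `L`, as a continuous complex function. -/
def IsBicharacter.restrict (hm : IsBicharacter m) (L : AddSubgroup G) (y : G) : C(L, ℂ) where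
  toFun a := m a y
  continuous_toFun := continuous_subtype_val.comp
    (hm.continuous.comp (continuous_subtype_val.prodMk continuous_const))

theorem IsBicharacter.restrict_apply (hm : IsBicharacter m) (y : G) (a : L) :
    hm.restrict L y a = m a y := rfl

theorem IsSymplecticBicharacter.topologicalClosure_span_restrict [CompactSpace L]
    (hm : IsSymplecticBicharacter m) :
    (Submodule.span ℂ (Set.range (hm.restrict L))).topologicalClosure = ⊤ := by
  let M : Submonoid C(L, ℂ) :=
    { carrier := Set.range (hm.restrict L)
      one_mem' := ⟨0, ContinuousMap.ext fun a => by simp [hm.restrict_apply, hm.map_zero_right]⟩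
      mul_mem' := by
        rintro _ _ ⟨y, rfl⟩ ⟨z, rfl⟩
        exact ⟨y + z, ContinuousMap.ext fun a => by simp [hm.restrict_apply, hm.map_add_right]⟩ }
  refine topologicalClosure_span_eq_top_of_separatesPoints M ?_ fun a b hab => ?_
  · rintro _ ⟨y, rfl⟩
    exact ⟨-y, ContinuousMap.ext fun a => by
      rw [hm.restrict_apply, hm.map_neg_right, Circle.coe_inv_eq_conj]
      rfl⟩
  · by_contra! h
    exact hab (Subtype.ext (hm.eq_of_forall_eq fun y => Circle.coe_injective (h _ ⟨y, rfl⟩)))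

section Average

variable [MeasurableSpace L] [BorelSpace L]

theorem IsMRep.exists_integral_restrict_smul_ne_zero [T2Space G] [CompactSpace L]
    [CompleteSpace H] (hW : IsMRep m W) (hm : IsSymplecticBicharacter m) (μ : Measure L)
    [IsFiniteMeasure μ] [μ.WeaklyRegular] [NeZero μ] {ψ : H} (hψ : ψ ≠ 0) :
    ∃ y, ∫ a, hm.restrict L y a • W a ψ ∂μ ≠ 0 := by
  have horbit : StronglyMeasurable fun a : L => W a ψ := by
    let : MeasurableSpace G := _root_.borel G
    have : BorelSpace G := ⟨rfl⟩
    exact (hW.borel ψ).comp_measurable continuous_subtype_val.measurable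
  have horbit2 : MemLp (fun a : L => W a ψ) 2 μ :=
    MemLp.of_bound horbit.aestronglyMeasurable ‖ψ‖ (.of_forall fun a => ((W a).norm_map ψ).le)
  by_contra! h
  obtain ⟨a, ha⟩ := (ae_eq_zero_of_forall_integral_smul_eq_zero
    hm.topologicalClosure_span_restrict horbit2 (Set.forall_mem_range.2 h)).exists
  exact hψ ((W (a : G)).map_eq_zero_iff.1 ha)

theorem IsMRep.map_integral_restrict_smul [IsTopologicalAddGroup G] (hW : IsMRep m W)
    (hm : IsSymplecticBicharacter m) (hL : IsIsotropic m L) (μ : Measure L)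
    [μ.IsAddLeftInvariant] (y : G) (ψ : H) (b : L) :
    W b (∫ a, hm.restrict L y a • W a ψ ∂μ) =
      ((m b y)⁻¹ : Circle) • ∫ a, hm.restrict L y a • W a ψ ∂μ := by
  have translate (a : L) : W b (hm.restrict L y a • W a ψ) =
      ((m b y)⁻¹ : Circle) • hm.restrict L y (b + a) • W (b + a : L) ψ := by
    simp only [map_smul, hW.map_map, hL b b.2 a a.2, hm.restrict_apply, AddSubgroup.coe_add,
      hm.map_add_left, Circle.coe_mul, Circle.coe_one, one_smul, Circle.smul_def, smul_smul]
    rw [← mul_assoc, ← Circle.coe_mul, inv_mul_cancel, Circle.coe_one, one_mul]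
  calc W b (∫ a, hm.restrict L y a • W a ψ ∂μ)
      = ∫ a, W b (hm.restrict L y a • W a ψ) ∂μ :=
        ((W b).toContinuousLinearEquiv.integral_comp_comm _).symm
    _ = ((m b y)⁻¹ : Circle) • ∫ a, hm.restrict L y (b + a) • W (b + a : L) ψ ∂μ := by
        simp_rw [translate]
        exact integral_smul _ _
    _ = ((m b y)⁻¹ : Circle) • ∫ a, hm.restrict L y a • W a ψ ∂μ := by
        rw [integral_add_left_eq_self fun a => hm.restrict L y a • W a ψ]

end Average

theorem IsMRep.nontrivial_vacuumSpace [IsTopologicalAddGroup G] [T2Space G] [CompleteSpace H]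
    [Nontrivial H] (hW : IsMRep m W) (hm : IsSymplecticBicharacter m)
    (h2 : Function.Surjective fun x : G => 2 • x) (hL : IsIsotropic m L)
    (hLc : IsCompact (L : Set G)) : Nontrivial (vacuumSpace W L) := by
  have : CompactSpace L := isCompact_iff_compactSpace.1 hLc
  let : MeasurableSpace L := _root_.borel L
  have : BorelSpace L := ⟨rfl⟩
  let μ : Measure L := Measure.addHaar
  obtain ⟨ψ, hψ⟩ := exists_ne (0 : H)
  obtain ⟨y, hy⟩ := hW.exists_integral_restrict_smul_ne_zero hm μ hψ
  obtain ⟨x, rfl⟩ := h2 y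
  set φ := ∫ a, hm.restrict L (2 • x) a • W a ψ ∂μ
  have hφ (b : G) (hb : b ∈ L) : W b φ = ((m b (2 • x))⁻¹ : Circle) • φ :=
    hW.map_integral_restrict_smul hm hL μ (2 • x) ψ ⟨b, hb⟩
  have hvac : W x φ ∈ vacuumSpace W L := fun b hb => by
    rw [hW.map_comm hm, hφ b hb, Circle.smul_def, map_smul, smul_smul, hm.map_two_nsmul,
      ← Circle.coe_mul, mul_inv_cancel, Circle.coe_one, one_smul]
  exact ⟨⟨W x φ, hvac⟩, 0, fun h => hy ((W x).map_eq_zero_iff.1 (congrArg Subtype.val h))⟩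

end Vacuum

/-! ### The descent to `(L/2)/L` -/

theorem isClosed_vacuumSpace {G : Type*} [AddCommGroup G] {H : Type*} [NormedAddCommGroup H]
    [InnerProductSpace ℂ H] (W : G → (H ≃ₗᵢ[ℂ] H)) (L : AddSubgroup G) :
    IsClosed (vacuumSpace W L : Set H) := by
  have hinter : (vacuumSpace W L : Set H) = ⋂ a ∈ L, {ψ | W a ψ = ψ} := by
    ext ψ
    rw [Set.mem_iInter₂]
    rfl
  rw [hinter]
  exact isClosed_biInter fun a _ => isClosed_eq (W a).continuous continuous_id

section Descent

variable {G : Type*} [AddCommGroup G] [TopologicalSpace G] {m : G → G → Circle}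
  {H : Type*} [NormedAddCommGroup H] [InnerProductSpace ℂ H] {W : G → (H ≃ₗᵢ[ℂ] H)}
  {L : AddSubgroup G}

theorem IsMRep.map_mem_vacuumSpace (hW : IsMRep m W) (hm : IsSymplecticBicharacter m)
    (hL : Maximal (IsIsotropic m) L) {x : G} (hx : x ∈ halfSubgroup L) {ψ : H}
    (hψ : ψ ∈ vacuumSpace W L) : W x ψ ∈ vacuumSpace W L := fun a ha => by
  rw [hW.map_comm hm, hψ a ha, (hm.mem_halfSubgroup_iff hL).1 hx a ha, Circle.coe_one, one_smul]

theorem IsMRep.map_neg_map (hW : IsMRep m W) (hm : IsSymplecticBicharacter m) (x : G) (ψ : H) :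
    W (-x) (W x ψ) = ψ := by
  rw [hW.map_map, hm.map_neg_left, hm.self_eq_one, inv_one, Circle.coe_one, one_smul,
    neg_add_cancel, hW.map_zero]

theorem IsMRep.inner_map_eq_zero (hW : IsMRep m W) (hm : IsSymplecticBicharacter m)
    (hL : Maximal (IsIsotropic m) L) {x : G} (hx : x ∉ halfSubgroup L) {φ ψ : H}
    (hφ : φ ∈ vacuumSpace W L) (hψ : ψ ∈ vacuumSpace W L) : ⟪W x φ, ψ⟫_ℂ = 0 := by
  rw [hm.mem_halfSubgroup_iff hL] at hx
  push Not at hx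
  obtain ⟨a, ha, hne⟩ := hx
  have hinner : ((m (2 • a) x)⁻¹ : Circle) * ⟪W x φ, ψ⟫_ℂ = ⟪W x φ, ψ⟫_ℂ := by
    calc ((m (2 • a) x)⁻¹ : Circle) * ⟪W x φ, ψ⟫_ℂ
        = ⟪W a (W x φ), W a ψ⟫_ℂ := by
          rw [hW.map_comm hm, hφ a ha, hψ a ha, inner_smul_left, Circle.coe_inv_eq_conj]
      _ = ⟪W x φ, ψ⟫_ℂ := (W a).inner_map_map _ _
  by_contra h0
  exact hne (inv_eq_one.1 (Circle.coe_eq_one.1 ((mul_eq_right₀ h0).1 hinner)))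

/-- The action of `W x`, `x ∈ L/2`, on the vacuum space. -/
noncomputable def IsMRep.vacuumAction (hW : IsMRep m W) (hm : IsSymplecticBicharacter m)
    (hL : Maximal (IsIsotropic m) L) (x : halfSubgroup L) :
    vacuumSpace W L ≃ₗᵢ[ℂ] vacuumSpace W L where
  toFun ψ := ⟨W x ψ, hW.map_mem_vacuumSpace hm hL x.2 ψ.2⟩
  invFun ψ := ⟨W (-x) ψ, hW.map_mem_vacuumSpace hm hL (neg_mem x.2) ψ.2⟩
  map_add' φ ψ := Subtype.ext (map_add (W x) _ _)
  map_smul' c ψ := Subtype.ext (map_smul (W x) _ _)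
  left_inv ψ := Subtype.ext (hW.map_neg_map hm _ _)
  right_inv ψ := Subtype.ext (by simpa using hW.map_neg_map hm (-(x : G)) ψ)
  norm_map' ψ := (W x).norm_map ψ

theorem IsMRep.coe_vacuumAction (hW : IsMRep m W) (hm : IsSymplecticBicharacter m)
    (hL : Maximal (IsIsotropic m) L) (x : halfSubgroup L) (ψ : vacuumSpace W L) :
    (hW.vacuumAction hm hL x ψ : H) = W x ψ := rfl

theorem IsMRep.exists_map_eq_smul_map (hW : IsMRep m W) {x y : G} (hxy : -x + y ∈ L) :
    ∃ c : Circle, ∀ ψ ∈ vacuumSpace W L, W y ψ = (c : ℂ) • W x ψ := by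
  refine ⟨(m x (-x + y))⁻¹, fun ψ hψ => ?_⟩
  have h := hW.map_map x (-x + y) ψ
  rw [hψ _ hxy, add_neg_cancel_left] at h
  rw [h, smul_smul, ← Circle.coe_mul, inv_mul_cancel, Circle.coe_one, one_smul]

theorem IsMRep.exists_isVacuumDescent (hW : IsMRep m W) (hm : IsSymplecticBicharacter m)
    (hL : Maximal (IsIsotropic m) L) [DiscreteTopology (HalfQuotient L)]
    [Finite (HalfQuotient L)] : ∃ m₀ W₀, IsVacuumDescent W L m₀ W₀ := by
  let s : HalfQuotient L → halfSubgroup L := Quotient.out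
  have hs (v : HalfQuotient L) : QuotientAddGroup.mk (s v) = v := Quotient.out_eq' v
  have sub_mem (x y : halfSubgroup L)
      (h : (QuotientAddGroup.mk x : HalfQuotient L) = QuotientAddGroup.mk y) : (-x + y : G) ∈ L :=
    AddSubgroup.mem_addSubgroupOf.1 (QuotientAddGroup.eq.1 h)
  choose c hc using fun v w => hW.exists_map_eq_smul_map
    (sub_mem (s (v + w)) (s v + s w) (by rw [hs, QuotientAddGroup.mk_add, hs, hs]))
  choose a ha using fun x => hW.exists_map_eq_smul_map (sub_mem x (s (QuotientAddGroup.mk x))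
    (hs _).symm)
  refine ⟨fun v w => m (s v) (s w) * c v w, fun v => hW.vacuumAction hm hL (s v),
    ⟨fun ψ => ?_, fun v w ψ => ?_, fun ψ => ?_⟩, a, fun x ψ => ha x ψ ψ.2⟩
  · exact Subtype.ext (ψ.2 _ (by simpa using sub_mem 0 (s 0) (hs 0).symm))
  · refine Subtype.ext ?_
    rw [Submodule.coe_smul, hW.coe_vacuumAction, hW.coe_vacuumAction, hW.coe_vacuumAction,
      hW.map_map, ← AddSubgroup.coe_add, hc v w ψ ψ.2, smul_smul, ← Circle.coe_mul]
  · let : MeasurableSpace (HalfQuotient L) := _root_.borel (HalfQuotient L)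
    have : BorelSpace (HalfQuotient L) := ⟨rfl⟩
    exact StronglyMeasurable.of_discrete

variable {m₀ : HalfQuotient L → HalfQuotient L → Circle}
  {W₀ : HalfQuotient L → (vacuumSpace W L ≃ₗᵢ[ℂ] vacuumSpace W L)}

theorem IsVacuumDescent.isIrreducibleFamily [CompleteSpace H] [Nontrivial (vacuumSpace W L)]
    (hd : IsVacuumDescent W L m₀ W₀) (hm : IsSymplecticBicharacter m)
    (hL : Maximal (IsIsotropic m) L) (hW : IsMRep m W) (hirr : IsIrreducibleFamily W) :
    IsIrreducibleFamily W₀ := by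
  refine ⟨inferInstance, fun K hK invariant => or_iff_not_imp_left.2 fun hK0 => ?_⟩
  obtain ⟨c, hc⟩ := hd.lift
  obtain ⟨k, hk, hk0⟩ := K.exists_mem_ne_zero_of_ne_bot hK0
  have : CompleteSpace (vacuumSpace W L) := (isClosed_vacuumSpace W L).completeSpace_coe
  have : CompleteSpace K := hK.completeSpace_coe
  refine K.orthogonal_eq_bot_iff.1 ((Submodule.eq_bot_iff _).2 fun ψ hψ => ?_)
  suffices ∀ x, ⟪W x (k : H), (ψ : H)⟫_ℂ = 0 from
    Subtype.ext (hW.eq_zero_of_forall_inner_map_eq_zero hirr (Subtype.coe_ne_coe.2 hk0) this)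
  intro x
  by_cases hx : x ∈ halfSubgroup L
  · have horth : ⟪(W₀ (QuotientAddGroup.mk ⟨x, hx⟩) k : H), (ψ : H)⟫_ℂ = 0 :=
      hψ _ (invariant _ k hk)
    rw [hc, inner_smul_left] at horth
    exact (mul_eq_zero.1 horth).resolve_left (by simp)
  · exact hW.inner_map_eq_zero hm hL hx k.2 ψ.2

theorem IsVacuumDescent.multiplierCommutator_mk_mk [Nontrivial (vacuumSpace W L)]
    (hd : IsVacuumDescent W L m₀ W₀) (hm : IsSymplecticBicharacter m) (hW : IsMRep m W)
    (x y : halfSubgroup L) :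
    multiplierCommutator m₀ (QuotientAddGroup.mk x) (QuotientAddGroup.mk y) = m (2 • x) y := by
  obtain ⟨c, hc⟩ := hd.lift
  obtain ⟨ψ, hψ⟩ := exists_ne (0 : vacuumSpace W L)
  let φ : H := W₀ (QuotientAddGroup.mk y) (W₀ (QuotientAddGroup.mk x) ψ)
  have hφ : φ ≠ 0 := by simpa [φ] using hψ
  refine circle_smul_left_injective hφ ?_
  calc _ = (W₀ (QuotientAddGroup.mk x) (W₀ (QuotientAddGroup.mk y) ψ) : H) := by
        rw [hd.isMRep.map_map_comm]; rfl
    _ = (c x : ℂ) • (c y : ℂ) • (m (2 • x) y : ℂ) • W y (W x ψ) := by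
        rw [hc, hc, map_smul, hW.map_comm hm]
    _ = (m (2 • x) y : ℂ) • φ := by
        simp only [φ, hc, map_smul]
        rw [smul_comm (c x : ℂ), smul_comm (c x : ℂ), smul_comm (c y : ℂ)]

theorem IsVacuumDescent.isNondegenerateMultiplier [Nontrivial (vacuumSpace W L)]
    (hd : IsVacuumDescent W L m₀ W₀) (hm : IsSymplecticBicharacter m) (hW : IsMRep m W)
    (h2 : Function.Surjective fun x : G => 2 • x) (hL : Maximal (IsIsotropic m) L) :
    IsNondegenerateMultiplier m₀ := by
  refine QuotientAddGroup.mk_surjective.forall.2 fun y hy => ?_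
  have hyL : (y : G) ∉ L := fun h => hy ((QuotientAddGroup.eq_zero_iff y).2 h)
  rw [hm.mem_iff_forall_halfSubgroup h2 hL] at hyL
  push Not at hyL
  obtain ⟨x, hx, hne⟩ := hyL
  exact ⟨QuotientAddGroup.mk ⟨x, hx⟩, by rwa [hd.multiplierCommutator_mk_mk hm hW]⟩

end Descent

theorem exists_prime_pow_of_sq_eq_card {p : ℕ} (hp : p.Prime) {V : Type*} [AddCommGroup V]
    [Module (ZMod p) V] [Finite V] [Nontrivial V] {n : ℕ} (hn : n ^ 2 = Nat.card V) :
    ∃ d : ℕ, 0 < d ∧ n = p ^ d ∧ Nat.card V = p ^ (2 * d) := by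
  have := Fact.mk hp
  have hcard : Nat.card V = p ^ finrank (ZMod p) V := by
    rw [Module.natCard_eq_pow_finrank (K := ZMod p), Nat.card_zmod]
  obtain ⟨d, -, rfl⟩ := (Nat.dvd_prime_pow hp).1 (hcard ▸ hn ▸ dvd_pow_self n two_ne_zero)
  have hd : Nat.card V = p ^ (2 * d) := by rw [← hn, ← pow_mul, mul_comm]
  refine ⟨d, Nat.pos_of_ne_zero ?_, rfl, hd⟩
  rintro rfl
  exact Finite.one_lt_card.ne' hd

theorem theorem4p8_general {G : Type*} [AddCommGroup G] [TopologicalSpace G]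
    [IsTopologicalAddGroup G] [T2Space G] (h2 : Function.Surjective fun x : G => 2 • x)
    {m : G → G → Circle} (hm : IsSymplecticBicharacter m) {L : AddSubgroup G}
    (hL : Maximal (IsIsotropic m) L) (hLc : IsCompact (L : Set G)) (hL2 : L ≠ doubleSubgroup L)
    {H : Type*} [NormedAddCommGroup H] [InnerProductSpace ℂ H] [CompleteSpace H]
    {W : G → (H ≃ₗᵢ[ℂ] H)} (hW : IsMRep m W) (hWirr : IsIrreducibleFamily W) :
    (∃ m₀ W₀, IsVacuumDescent W L m₀ W₀) ∧
    (∀ m₀ W₀, IsVacuumDescent W L m₀ W₀ →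
      IsIrreducibleFamily W₀ ∧
      ∀ (K : Type*) [NormedAddCommGroup K] [InnerProductSpace ℂ K]
        (W' : HalfQuotient L → (K ≃ₗᵢ[ℂ] K)),
        IsMRep m₀ W' → IsIrreducibleFamily W' →
        ∃ T : vacuumSpace W L ≃ₗᵢ[ℂ] K, ∀ v ψ, T (W₀ v ψ) = W' v (T ψ)) ∧
    ∃ d : ℕ, 0 < d ∧ finrank ℂ (vacuumSpace W L) = 2 ^ d ∧
      Nat.card (HalfQuotient L) = 2 ^ (2 * d) := by
  have := hWirr.nontrivial
  have := hm.discreteTopology_halfQuotient hL hLc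
  have := hm.finite_halfQuotient h2 hL hLc
  have := hW.nontrivial_vacuumSpace hm h2 hL.prop hLc
  have : Nontrivial (HalfQuotient L) := not_subsingleton_iff_nontrivial.1 fun _ =>
    hL2 (eq_doubleSubgroup_of_subsingleton h2)
  have irreducible {m₀ W₀} (hd : IsVacuumDescent W L m₀ W₀) : IsIrreducibleFamily W₀ :=
    hd.isIrreducibleFamily hm hL hW hWirr
  have nondegenerate {m₀ W₀} (hd : IsVacuumDescent W L m₀ W₀) : IsNondegenerateMultiplier m₀ :=
    hd.isNondegenerateMultiplier hm hW h2 hL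
  obtain ⟨m₀, W₀, hd⟩ := hW.exists_isVacuumDescent hm hL
  exact ⟨⟨m₀, W₀, hd⟩,
    fun _ _ hd => ⟨irreducible hd, fun K _ _ W' hW' hirr' =>
      hd.isMRep.exists_unitary_equiv hW' (nondegenerate hd) (irreducible hd) hirr'⟩,
    exists_prime_pow_of_sq_eq_card Nat.prime_two
      (hd.isMRep.finrank_sq_eq_card (nondegenerate hd) (irreducible hd))⟩

theorem theorem4p8 {G : Type*} [AddCommGroup G] [TopologicalSpace G] [IsTopologicalAddGroup G]
    [T2Space G] [LocallyCompactSpace G] [TopologicalSpace.SeparableSpace G]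
    (h2reg : Function.Bijective (fun x : G => 2 • x))
    (m : G → G → Circle) (hm : IsSymplecticBicharacter m)
    (L : AddSubgroup G) (hL : Maximal (IsIsotropic m) L) (hLc : IsCompact (L : Set G))
    (hL2 : L ≠ doubleSubgroup L)
    {H : Type*} [NormedAddCommGroup H] [InnerProductSpace ℂ H] [CompleteSpace H]
    (W : G → (H ≃ₗᵢ[ℂ] H)) (hW : IsMRep m W) (hWirr : IsIrreducibleFamily W) :
    (∃ m₀ W₀, IsVacuumDescent W L m₀ W₀) ∧
    (∀ m₀ W₀, IsVacuumDescent W L m₀ W₀ →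
      IsIrreducibleFamily W₀ ∧
      ∀ (K : Type*) [NormedAddCommGroup K] [InnerProductSpace ℂ K] [CompleteSpace K]
        (W' : HalfQuotient L → (K ≃ₗᵢ[ℂ] K)),
        IsMRep m₀ W' → IsIrreducibleFamily W' →
        ∃ T : vacuumSpace W L ≃ₗᵢ[ℂ] K, ∀ v ψ, T (W₀ v ψ) = W' v (T ψ)) ∧
    ∃ d : ℕ, 0 < d ∧ Module.finrank ℂ (vacuumSpace W L) = 2 ^ d ∧
      Nat.card (HalfQuotient L) = 2 ^ (2 * d) := by
  have ⟨hex, huniq, hdim⟩ := theorem4p8_general h2reg.surjective hm hL hLc hL2 hW hWirr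
  exact ⟨hex, fun m₀ W₀ hd => (huniq m₀ W₀ hd).imp_right fun h K _ _ _ => h K, hdim⟩
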